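/- Let $A$ and $B$ be $C^*$-algebras (not necessarily unital). *Conventions.* A (right) Hilbert $B$-module is a complex vector space $E$ with a right $B$-action and a $B$-valued inner product $\langle\cdot,\cdot\rangle$, linear in the second variable, with $\langle x,yb\rangle=\langle x,y\rangle b$ and $\langle x,y\rangle^*=\langle y,x\rangle$, positive definite, and complete for the norm $\|x\|=\|\langle x,x\rangle\|^{1/2}$. $\mathcal L(E,F)$ is the set of adjointable maps $E\to F$, i.e. of functions $T:E\to F$ for which there is $T^*:F\to E$ with $\langle Tx,y\rangle=\langle x,T^*y\rangle$ for all $x,y$; $\mathcal L(E)=\mathcal L(E,E)$ is a $C^*$-algebra for the operator norm. The strict topology on $\mathcal L(E)$ is defined by the seminorms $T\mapsto\|Tx\|$ and $T\mapsto\|T^*x\|$, $x\in E$. A completely positive map $\varphi:A\to\mathcal L(E)$ is *strict* if there is an approximate unit $(a_\lambda)$ of $A$ (consisting of positive contractions) such that $(\varphi(a_\lambda))$ is a Cauchy net for the strict topology. *The category $\mathrm{PosCor}(A,B)$.* Its objects are the pairs $(E,\varphi)$ of a Hilbert $B$-module $E$ and a strict completely positive map $\varphi:A\to\mathcal L(E)$.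 A morphism $(E_1,\varphi_1)\to(E_2,\varphi_2)$ is a pair $(\eta,\alpha)$ with $\eta\in\mathcal L(E_1,E_2)$ and $\alpha$ a $*$-automorphism of $A$ such that $\varphi_2(\alpha(a))\circ\eta=\eta\circ\varphi_1(a)$ for all $a\in A$. The composite of $(\eta,\alpha)$ followed by $(\xi,\beta)$ is $(\xi\circ\eta,\beta\circ\alpha)$, and the identity of $(E,\varphi)$ is $(\mathrm{id}_E,\mathrm{id}_A)$. *The KSGNS construction.* For an object $(E,\varphi)$, the formula $\langle a\otimes x,b\otimes y\rangle=\langle x,\varphi(a^*b)y\rangle$ defines a $B$-valued semi-inner product on the algebraic tensor product $A\otimes_{\mathrm{alg}}E$ over $\mathbb C$. Let $N_\varphi=\{z:\langle z,z\rangle=0\}$ and let the Hilbert $B$-module $F_\varphi$ be the completion of $(A\otimes_{\mathrm{alg}}E)/N_\varphi$; write $a\mathbin{\dot\otimes}x\in F_\varphi$ for the class of $a\otimes x$. Let $\pi_\varphi:A\to\mathcal L(F_\varphi)$ be the $*$-homomorphism with $\pi_\varphi(a)(b\mathbin{\dot\otimes}x)=ab\mathbin{\dot\otimes}x$; then $(F_\varphi,\pi_\varphi)$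 is again an object of $\mathrm{PosCor}(A,B)$. **Theorem.** For every morphism $(\eta,\alpha):(E_1,\varphi_1)\to(E_2,\varphi_2)$ of $\mathrm{PosCor}(A,B)$ there is a unique morphism $(\tilde\eta,\alpha):(F_{\varphi_1},\pi_{\varphi_1})\to(F_{\varphi_2},\pi_{\varphi_2})$ such that $$\tilde\eta(a\mathbin{\dot\otimes}x)=\alpha(a)\mathbin{\dot\otimes}\eta(x)\qquad\text{for all }a\in A,\ x\in E_1,$$ and the assignment $(E,\varphi)\mapsto(F_\varphi,\pi_\varphi)$, $(\eta,\alpha)\mapsto(\tilde\eta,\alpha)$ is a covariant functor $\mathrm{PosCor}(A,B)\to\mathrm{PosCor}(A,B)$. Equivalently, there is exactly one endofunctor of $\mathrm{PosCor}(A,B)$ that sends each object $(E,\varphi)$ to $(F_\varphi,\pi_\varphi)$ and each morphism $(\eta,\alpha)$ to a morphism of the form $(\tilde\eta,\alpha)$ with $\tilde\eta(a\mathbin{\dot\otimes}x)=\alpha(a)\mathbin{\dot\otimes}\eta(x)$ for all $a$, $x$. -/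

import Mathlib

open CategoryTheory TensorProduct Filter Topology MulOpposite
open scoped CStarAlgebra

universe u v w w₁ w₂ w₃

noncomputable section

/-- A complex vector space `E` with a right action of `B` (written `op b • x` for `x b`) and a
`B`-valued semi-inner product, linear in the second variable: all the axioms of an inner product
`B`-module except that `⟨x, x⟩ = 0` need not imply `x = 0`. -/
class SemiInnerModule (B : Type v) [NonUnitalCStarAlgebra B] [PartialOrder B]
    (E : Type w) [AddCommGroup E] [Module ℂ E] extends SMul Bᵐᵒᵖ E, Inner B E where
  op_smul_add (b : B) (x y : E) : op b • (x + y) = op b • x + op b • y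
  add_op_smul (b c : B) (x : E) : op (b + c) • x = op b • x + op c • x
  mul_op_smul (b c : B) (x : E) : op (b * c) • x = op c • op b • x
  smul_op_smul (z : ℂ) (b : B) (x : E) : op (z • b) • x = z • op b • x
  op_smul_smul (z : ℂ) (b : B) (x : E) : op b • z • x = z • op b • x
  inner_self_nonneg (x : E) : 0 ≤ inner x x
  inner_add_right (x y z : E) : inner x (y + z) = inner x y + inner x z
  inner_smul_right (x y : E) (z : ℂ) : inner x (z • y) = z • inner x y
  star_inner (x y : E) : star (inner x y) = inner y x
  inner_op_smul_right (x y : E) (b : B) : inner x (op b • y) = inner x y * b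

/-- A (right) Hilbert `B`-module: a complex vector space with a right action of `B` and a
`B`-valued inner product, which is complete for the norm `‖x‖ = ‖⟨x, x⟩‖ ^ (1 / 2)`. -/
class HilbertModule (B : Type v) [NonUnitalCStarAlgebra B] [PartialOrder B]
    (E : Type w) [NormedAddCommGroup E] [NormedSpace ℂ E] [CompleteSpace E]
    extends SemiInnerModule B E where
  inner_self_eq_zero (x : E) : inner x x = 0 ↔ x = 0
  norm_eq_sqrt (x : E) : ‖x‖ = √‖inner x x‖

namespace SemiInnerModule

section

variable {B : Type v} [NonUnitalCStarAlgebra B] [PartialOrder B]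
  {E : Type w} [AddCommGroup E] [Module ℂ E] [SemiInnerModule B E]

theorem inner_add_left (x y z : E) : inner B (x + y) z = inner B x z + inner B y z := by
  rw [← star_inner, inner_add_right, star_add, star_inner, star_inner]

theorem inner_smul_left (x y : E) (z : ℂ) : inner B (z • x) y = star z • inner B x y := by
  rw [← star_inner, inner_smul_right, star_smul, star_inner]

theorem inner_op_smul_left (x y : E) (b : B) : inner B (op b • x) y = star b * inner B x y := by
  rw [← star_inner, inner_op_smul_right, star_mul, star_inner]

variable (B E) in
/-- The semi-inner product as a sesquilinear map. -/
def innerₛₗ : E →ₗ⋆[ℂ] E →ₗ[ℂ] B :=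
  LinearMap.mk₂'ₛₗ _ _ (fun x y => inner B x y) inner_add_left
    (fun z x y => inner_smul_left x y z) inner_add_right (fun z x y => inner_smul_right x y z)

theorem innerₛₗ_apply (x y : E) : innerₛₗ B E x y = inner B x y := rfl

theorem inner_sub_right (x y z : E) : inner B x (y - z) = inner B x y - inner B x z := by
  simp only [← innerₛₗ_apply, map_sub]

theorem inner_sub_left (x y z : E) : inner B (x - y) z = inner B x z - inner B y z := by
  simp only [← innerₛₗ_apply, map_sub, LinearMap.sub_apply]

theorem inner_zero_right (x : E) : inner B x (0 : E) = 0 := by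
  simp only [← innerₛₗ_apply, map_zero]

theorem inner_sum_right {ι : Type*} (s : Finset ι) (x : E) (y : ι → E) :
    inner B x (∑ i ∈ s, y i) = ∑ i ∈ s, inner B x (y i) := by
  simp only [← innerₛₗ_apply, map_sum]

theorem inner_sum_left {ι : Type*} (s : Finset ι) (x : ι → E) (y : E) :
    inner B (∑ i ∈ s, x i) y = ∑ i ∈ s, inner B (x i) y := by
  simp only [← innerₛₗ_apply, map_sum, LinearMap.sum_apply]

theorem op_smul_sub (b : B) (x y : E) : op b • (x - y) = op b • x - op b • y := by
  rw [eq_sub_iff_add_eq, ← op_smul_add, sub_add_cancel]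

theorem sqrt_norm_inner_smul (z : ℂ) (x : E) :
    √‖inner B (z • x) (z • x)‖ = ‖z‖ * √‖inner B x x‖ := by
  rw [inner_smul_right, inner_smul_left, smul_smul, norm_smul, norm_mul, norm_star,
    Real.sqrt_mul (by positivity), Real.sqrt_mul_self (norm_nonneg z)]

theorem sqrt_norm_inner_op_smul_le (b : B) (x : E) :
    √‖inner B (op b • x) (op b • x)‖ ≤ ‖b‖ * √‖inner B x x‖ := by
  rw [inner_op_smul_right, inner_op_smul_left]
  refine Real.sqrt_le_left (by positivity) |>.2 ?_
  rw [mul_pow, Real.sq_sqrt (norm_nonneg _)]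
  calc ‖star b * inner B x x * b‖ ≤ ‖star b‖ * ‖inner B x x‖ * ‖b‖ := norm_mul₃_le
    _ = ‖b‖ ^ 2 * ‖inner B x x‖ := by rw [norm_star]; ring

variable [StarOrderedRing B]

/-- The Cauchy-Schwarz inequality. -/
theorem norm_inner_sq_le (x y : E) :
    ‖inner B x y‖ ^ 2 ≤ ‖inner B x x‖ * ‖inner B y y‖ := by
  set c : B := inner B x y with hc
  have key : ∀ t : ℝ, ‖inner B x x‖ < t → ‖c‖ ^ 2 ≤ t * ‖inner B y y‖ := by
    intro t ht
    have ht0 : 0 < t := (norm_nonneg _).trans_lt ht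
    have h0 := inner_self_nonneg (B := B) (op c • x - (t : ℂ) • y)
    have hyx : inner B y x = star c := by rw [hc, star_inner]
    simp only [inner_sub_right, inner_sub_left, inner_op_smul_right, inner_op_smul_left,
      inner_smul_right, inner_smul_left, hyx, ← hc, Complex.star_def, Complex.conj_ofReal,
      smul_mul_assoc, sub_mul] at h0
    simp only [Complex.coe_smul] at h0
    have h1 : star c * inner B x x * c ≤ ‖inner B x x‖ • (star c * c) := by
      have hsa : IsSelfAdjoint (inner B x x) := star_inner x x
      exact CStarAlgebra.star_left_conjugate_le_norm_smul
    have h2 : ‖inner B x x‖ • (star c * c) ≤ t • (star c * c) :=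
      smul_le_smul_of_nonneg_right ht.le (star_mul_self_nonneg c)
    have h3 : t • (star c * c) ≤ t • t • inner B y y := by
      rw [← sub_nonneg]
      have := h0.trans (sub_le_sub_right (sub_le_sub_right (h1.trans h2) _) _)
      refine this.trans_eq ?_
      rw [smul_sub]
      abel
    have h4 : star c * c ≤ t • inner B y y := by
      have := smul_le_smul_of_nonneg_left h3 (inv_nonneg.2 ht0.le)
      rwa [smul_smul, smul_smul, inv_mul_cancel₀ ht0.ne', one_smul, one_smul] at this
    calc ‖c‖ ^ 2 = ‖star c * c‖ := by rw [CStarRing.norm_star_mul_self, sq]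
      _ ≤ ‖t • inner B y y‖ :=
        CStarAlgebra.norm_le_norm_of_nonneg_of_le (star_mul_self_nonneg c) h4
      _ = t * ‖inner B y y‖ := by rw [norm_smul, Real.norm_of_nonneg ht0.le]
  refine le_of_tendsto_of_tendsto (b := 𝓝[>] ‖inner B x x‖) tendsto_const_nhds
    (Tendsto.mono_left (Continuous.tendsto (by fun_prop) _) nhdsWithin_le_nhds)
    (f := fun _ => ‖c‖ ^ 2) (g := fun t => t * ‖inner B y y‖) ?_
  filter_upwards [self_mem_nhdsWithin] with t ht using key t ht

theorem norm_inner_le (x y : E) :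
    ‖inner B x y‖ ≤ √‖inner B x x‖ * √‖inner B y y‖ := by
  rw [← Real.sqrt_mul (norm_nonneg _)]
  exact Real.le_sqrt_of_sq_le (norm_inner_sq_le x y)

theorem sqrt_norm_inner_add_le (x y : E) :
    √‖inner B (x + y) (x + y)‖ ≤ √‖inner B x x‖ + √‖inner B y y‖ := by
  refine Real.sqrt_le_left (by positivity) |>.2 ?_
  have hx := Real.sq_sqrt (norm_nonneg (inner B x x))
  have hy := Real.sq_sqrt (norm_nonneg (inner B y y))
  have h1 := norm_inner_le (B := B) x y
  have h2 := norm_inner_le (B := B) y x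
  rw [inner_add_right, inner_add_left, inner_add_left]
  have h3 := norm_add_le (inner B x x + inner B y x) (inner B x y + inner B y y)
  have h4 := norm_add_le (inner B x x) (inner B y x)
  have h5 := norm_add_le (inner B x y) (inner B y y)
  nlinarith

end

end SemiInnerModule

namespace HilbertModule

open SemiInnerModule

variable {B : Type v} [NonUnitalCStarAlgebra B] [PartialOrder B]
  {E : Type w} [NormedAddCommGroup E] [NormedSpace ℂ E] [CompleteSpace E] [HilbertModule B E]

theorem norm_sq_eq (x : E) : ‖x‖ ^ 2 = ‖inner B x x‖ := by
  rw [norm_eq_sqrt (B := B), Real.sq_sqrt (norm_nonneg _)]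

theorem ext_inner_right {x y : E} (h : ∀ z : E, inner B z x = inner B z y) : x = y := by
  rw [← sub_eq_zero, ← inner_self_eq_zero (B := B), SemiInnerModule.inner_sub_right, h, sub_self]

theorem ext_inner_left {x y : E} (h : ∀ z : E, inner B x z = inner B y z) : x = y :=
  ext_inner_right (B := B) fun z => by rw [← star_inner, h, star_inner]

variable [StarOrderedRing B]

theorem norm_inner_le_norm (x y : E) : ‖inner B x y‖ ≤ ‖x‖ * ‖y‖ := by
  rw [norm_eq_sqrt (B := B) x, norm_eq_sqrt (B := B) y]
  exact norm_inner_le x y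

variable (B E) in
/-- The inner product as a continuous sesquilinear map. -/
def innerSL : E →L⋆[ℂ] E →L[ℂ] B :=
  LinearMap.mkContinuous₂ (innerₛₗ B E) 1 fun x y => by
    simpa [innerₛₗ_apply] using norm_inner_le_norm x y

theorem innerSL_apply (x y : E) : innerSL B E x y = inner B x y := rfl

theorem continuous_inner : Continuous fun p : E × E => inner B p.1 p.2 := by
  simp_rw [← innerSL_apply]
  fun_prop

end HilbertModule
/-- An adjointable map `E → F` between Hilbert `B`-modules: a function together with its
(necessarily unique, see `Adjointable.ext`) adjoint. -/
structure Adjointable (B : Type v) [NonUnitalCStarAlgebra B] [PartialOrder B]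
    (E : Type w₁) [NormedAddCommGroup E] [NormedSpace ℂ E] [CompleteSpace E] [HilbertModule B E]
    (F : Type w₂) [NormedAddCommGroup F] [NormedSpace ℂ F] [CompleteSpace F] [HilbertModule B F]
    where
  toFun : E → F
  adjFun : F → E
  inner_toFun_left (x : E) (y : F) : inner B (toFun x) y = inner B x (adjFun y)

namespace Adjointable

section

variable {B : Type v} [NonUnitalCStarAlgebra B] [PartialOrder B]
  {E : Type w₁} [NormedAddCommGroup E] [NormedSpace ℂ E] [CompleteSpace E] [HilbertModule B E]
  {F : Type w₂} [NormedAddCommGroup F] [NormedSpace ℂ F] [CompleteSpace F] [HilbertModule B F]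
  {G : Type w₃} [NormedAddCommGroup G] [NormedSpace ℂ G] [CompleteSpace G] [HilbertModule B G]

instance : CoeFun (Adjointable B E F) fun _ => E → F := ⟨toFun⟩

/-- The adjoint of an adjointable map. -/
def adjoint (T : Adjointable B E F) : Adjointable B F E where
  toFun := T.adjFun
  adjFun := T.toFun
  inner_toFun_left x y := by
    rw [← SemiInnerModule.star_inner, ← T.inner_toFun_left, SemiInnerModule.star_inner]

theorem inner_left (T : Adjointable B E F) (x : E) (y : F) :
    inner B (T x) y = inner B x (T.adjoint y) := T.inner_toFun_left x y

theorem inner_right (T : Adjointable B E F) (x : F) (y : E) :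
    inner B x (T y) = inner B (T.adjoint x) y := (T.adjoint.inner_left x y).symm

@[ext]
theorem ext {S T : Adjointable B E F} (h : ∀ x, S x = T x) : S = T := by
  have h1 : S.toFun = T.toFun := funext h
  have h2 : S.adjFun = T.adjFun := funext fun y => HilbertModule.ext_inner_right (B := B) fun z => by
    rw [← S.inner_toFun_left, ← T.inner_toFun_left, h1]
  cases S; cases T; simp_all

/-- The identity map. -/
def id : Adjointable B E E := ⟨fun x => x, fun x => x, fun _ _ => rfl⟩

/-- Composition of adjointable maps. -/
def comp (S : Adjointable B F G) (T : Adjointable B E F) : Adjointable B E G where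
  toFun x := S (T x)
  adjFun x := T.adjoint (S.adjoint x)
  inner_toFun_left x y := by rw [S.inner_left, T.inner_left]

theorem id_apply (x : E) : (id : Adjointable B E E) x = x := rfl

theorem comp_apply (S : Adjointable B F G) (T : Adjointable B E F) (x : E) :
    S.comp T x = S (T x) := rfl

theorem adjoint_adjoint (T : Adjointable B E F) : T.adjoint.adjoint = T := rfl

theorem map_add (T : Adjointable B E F) (x y : E) : T (x + y) = T x + T y :=
  HilbertModule.ext_inner_right (B := B) fun z => by
    simp only [SemiInnerModule.inner_add_right, inner_right]

theorem map_smul (T : Adjointable B E F) (z : ℂ) (x : E) : T (z • x) = z • T x :=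
  HilbertModule.ext_inner_right (B := B) fun z => by
    simp only [SemiInnerModule.inner_smul_right, inner_right]

theorem map_op_smul (T : Adjointable B E F) (b : B) (x : E) : T (op b • x) = op b • T x :=
  HilbertModule.ext_inner_right (B := B) fun z => by
    simp only [SemiInnerModule.inner_op_smul_right, inner_right]

/-- An adjointable map as a linear map. -/
def toLinearMap (T : Adjointable B E F) : E →ₗ[ℂ] F where
  toFun := T
  map_add' := T.map_add
  map_smul' := T.map_smul

instance : Zero (Adjointable B E F) :=
  ⟨⟨fun _ => 0, fun _ => 0, fun x y => by
    rw [SemiInnerModule.inner_zero_right, ← SemiInnerModule.star_inner,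
      SemiInnerModule.inner_zero_right, star_zero]⟩⟩

instance : Add (Adjointable B E F) :=
  ⟨fun S T => ⟨fun x => S x + T x, fun x => S.adjoint x + T.adjoint x, fun x y => by
    rw [SemiInnerModule.inner_add_left, SemiInnerModule.inner_add_right, S.inner_left,
      T.inner_left]⟩⟩

instance : SMul ℂ (Adjointable B E F) :=
  ⟨fun z T => ⟨fun x => z • T x, fun x => star z • T.adjoint x, fun x y => by
    rw [SemiInnerModule.inner_smul_left, SemiInnerModule.inner_smul_right, T.inner_left]⟩⟩

instance : Neg (Adjointable B E F) := ⟨fun T => (-1 : ℂ) • T⟩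

theorem zero_apply (x : E) : (0 : Adjointable B E F) x = 0 := rfl

theorem add_apply (S T : Adjointable B E F) (x : E) : (S + T) x = S x + T x := rfl

theorem smul_apply (z : ℂ) (T : Adjointable B E F) (x : E) : (z • T) x = z • T x := rfl

theorem neg_apply (T : Adjointable B E F) (x : E) : (-T) x = -T x := by
  change (-1 : ℂ) • T x = _
  rw [neg_one_smul]

instance : AddCommGroup (Adjointable B E F) where
  add_assoc S T U := by ext x; simp only [add_apply, add_assoc]
  zero_add T := by ext x; simp only [add_apply, zero_apply, zero_add]
  add_zero T := by ext x; simp only [add_apply, zero_apply, add_zero]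
  add_comm S T := by ext x; simp only [add_apply, add_comm]
  neg_add_cancel T := by ext x; simp only [add_apply, neg_apply, zero_apply, neg_add_cancel]
  nsmul := nsmulRec
  zsmul := zsmulRec

instance : One (Adjointable B E E) := ⟨id⟩

/-- The multiplication of `L(E)` is composition. -/
instance : Mul (Adjointable B E E) := ⟨comp⟩

/-- The involution of `L(E)` is the adjoint. -/
instance : Star (Adjointable B E E) := ⟨adjoint⟩

instance : Ring (Adjointable B E E) :=
  { (inferInstance : AddCommGroup (Adjointable B E E)),
    (inferInstance : One (Adjointable B E E)),
    (inferInstance : Mul (Adjointable B E E)) with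
    mul_assoc := fun _ _ _ => rfl
    one_mul := fun _ => rfl
    mul_one := fun _ => rfl
    zero_mul := fun T => by ext x; rfl
    mul_zero := fun T => by ext x; exact T.toLinearMap.map_zero
    left_distrib := fun S T U => by ext x; exact S.map_add _ _
    right_distrib := fun S T U => by ext x; rfl }

theorem one_apply (x : E) : (1 : Adjointable B E E) x = x := rfl

theorem mul_apply (S T : Adjointable B E E) (x : E) : (S * T) x = S (T x) := rfl

instance : Module ℂ (Adjointable B E F) where
  one_smul T := by ext x; simp only [smul_apply, one_smul]
  mul_smul a b T := by ext x; simp only [smul_apply, mul_smul]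
  smul_zero a := by ext x; simp only [smul_apply, zero_apply, smul_zero]
  smul_add a S T := by ext x; simp only [smul_apply, add_apply, smul_add]
  add_smul a b T := by ext x; simp only [smul_apply, add_apply, add_smul]
  zero_smul T := by ext x; simp only [smul_apply, zero_apply, zero_smul]

instance : Algebra ℂ (Adjointable B E E) :=
  Algebra.ofModule (fun _ _ _ => by ext x; rfl) (fun a S T => by ext x; exact S.map_smul a _)

instance : StarRing (Adjointable B E E) where
  star_involutive _ := rfl
  star_mul _ _ := rfl
  star_add _ _ := rfl

theorem star_apply (T : Adjointable B E E) (x : E) : star T x = T.adjoint x := rfl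

instance : StarModule ℂ (Adjointable B E E) := ⟨fun _ _ => by ext x; rfl⟩

theorem sum_apply {ι : Type*} (s : Finset ι) (T : ι → Adjointable B E E) (y : E) :
    (∑ k ∈ s, T k) y = ∑ k ∈ s, T k y :=
  map_sum (AddMonoidHom.mk' (fun U : Adjointable B E E => U y) fun _ _ => rfl) T s

theorem inner_star_mul (T S : Adjointable B E E) (x y : E) :
    inner B x ((star T * S) y) = inner B (T x) (S y) := by
  rw [T.inner_left]
  rfl

variable [StarOrderedRing B]

theorem continuous (T : Adjointable B E F) : Continuous T := by
  refine T.toLinearMap.continuous_of_seq_closed_graph fun u x y hu hTu => ?_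
  refine HilbertModule.ext_inner_right (B := B) fun z => ?_
  change inner B z y = inner B z (T x)
  have h1 : Tendsto (fun n => inner B z (T (u n))) atTop (𝓝 (inner B z y)) :=
    ((HilbertModule.innerSL B F z).continuous.tendsto y).comp hTu
  have h2 : Tendsto (fun n => inner B z (T (u n))) atTop (𝓝 (inner B z (T x))) := by
    simp_rw [inner_right]
    exact ((HilbertModule.innerSL B E (T.adjoint z)).continuous.tendsto x).comp hu
  exact tendsto_nhds_unique h1 h2

/-- An adjointable map as a continuous linear map. -/
def toCLM (T : Adjointable B E F) : E →L[ℂ] F := ⟨T.toLinearMap, T.continuous⟩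

theorem toCLM_apply (T : Adjointable B E F) (x : E) : T.toCLM x = T x := rfl

variable (B E) in
/-- The embedding of `L(E)` into the bounded operators. -/
def toCLMHom : Adjointable B E E →ₐ[ℂ] E →L[ℂ] E where
  toFun := toCLM
  map_one' := rfl
  map_mul' _ _ := rfl
  map_zero' := rfl
  map_add' _ _ := rfl
  commutes' z := by
    ext x
    change (algebraMap ℂ (Adjointable B E E) z) x = _
    rw [Algebra.algebraMap_eq_smul_one, Algebra.algebraMap_eq_smul_one]
    rfl

theorem toCLMHom_injective : Function.Injective (toCLMHom B E) := fun S T h => by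
  ext x
  exact congrArg (fun U : E →L[ℂ] E => U x) h

/-- `L(E)` carries the operator norm. -/
instance : NormedRing (Adjointable B E E) :=
  NormedRing.induced _ _ (toCLMHom B E) toCLMHom_injective

theorem norm_def (T : Adjointable B E E) : ‖T‖ = ‖T.toCLM‖ := rfl

instance : NormedAlgebra ℂ (Adjointable B E E) where
  norm_smul_le z T := by
    rw [norm_def, norm_def, ← norm_smul]
    rfl

theorem norm_apply_le (T : Adjointable B E E) (x : E) : ‖T x‖ ≤ ‖T‖ * ‖x‖ :=
  T.toCLM.le_opNorm x

theorem norm_apply_sq_le (T : Adjointable B E F) (x : E) :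
    ‖T x‖ ^ 2 ≤ ‖x‖ * ‖T.adjoint (T x)‖ := by
  rw [HilbertModule.norm_sq_eq (B := B), T.inner_left]
  exact HilbertModule.norm_inner_le_norm _ _

theorem norm_mul_self_le_norm_star_mul (T : Adjointable B E E) : ‖T‖ * ‖T‖ ≤ ‖star T * T‖ := by
  have h : ‖T‖ ≤ √‖star T * T‖ := by
    refine T.toCLM.opNorm_le_bound (Real.sqrt_nonneg _) fun x => ?_
    refine le_of_sq_le_sq ?_ (by positivity)
    rw [mul_pow, Real.sq_sqrt (norm_nonneg _)]
    calc ‖T x‖ ^ 2 ≤ ‖x‖ * ‖(star T * T) x‖ := T.norm_apply_sq_le x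
      _ ≤ ‖x‖ * (‖star T * T‖ * ‖x‖) := by gcongr; exact norm_apply_le _ _
      _ = ‖star T * T‖ * ‖x‖ ^ 2 := by ring
  rw [← sq]
  exact (Real.le_sqrt (norm_nonneg _) (norm_nonneg _)).1 h

instance : CStarRing (Adjointable B E E) := ⟨norm_mul_self_le_norm_star_mul⟩

/-- Limits of adjointable maps in the operator norm are adjointable. -/
instance : CompleteSpace (Adjointable B E E) := by
  refine Metric.complete_of_cauchySeq_tendsto fun u hu => ?_
  have hiso : Isometry (toCLMHom B E) := Isometry.of_dist_eq fun _ _ => rfl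
  have hu' : CauchySeq fun n => toCLMHom B E (u n) := hu.map hiso.uniformContinuous
  have hv' : CauchySeq fun n => toCLMHom B E (star (u n)) :=
    hu.map (hiso.comp star_isometry).uniformContinuous
  obtain ⟨S, hS⟩ := cauchySeq_tendsto_of_complete hu'
  obtain ⟨R, hR⟩ := cauchySeq_tendsto_of_complete hv'
  have hadj (x y : E) : inner B (S x) y = inner B x (R y) := by
    have h1 : Tendsto (fun n => inner B (u n x) y) atTop (𝓝 (inner B (S x) y)) := by
      have := ((ContinuousLinearMap.apply ℂ E x).continuous.tendsto S).comp hS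
      exact ((HilbertModule.continuous_inner (B := B)).comp
        (Continuous.prodMk_left y) |>.tendsto (S x)).comp this
    have h2 : Tendsto (fun n => inner B (u n x) y) atTop (𝓝 (inner B x (R y))) := by
      simp_rw [inner_left]
      have := ((ContinuousLinearMap.apply ℂ E y).continuous.tendsto R).comp hR
      exact ((HilbertModule.innerSL B E x).continuous.tendsto (R y)).comp this
    exact tendsto_nhds_unique h1 h2
  exact ⟨⟨S, R, hadj⟩, hiso.isUniformInducing.isInducing.tendsto_nhds_iff.2 hS⟩

instance : CStarAlgebra (Adjointable B E E) where

instance : PartialOrder (Adjointable B E E) := CStarAlgebra.spectralOrder _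

instance : StarOrderedRing (Adjointable B E E) := CStarAlgebra.spectralOrderedRing _

end

end Adjointable
section Strict

variable {A : Type u} [NonUnitalCStarAlgebra A] [PartialOrder A] [StarOrderedRing A]
  {B : Type v} [NonUnitalCStarAlgebra B] [PartialOrder B] [StarOrderedRing B]
  {E : Type w} [NormedAddCommGroup E] [NormedSpace ℂ E] [CompleteSpace E] [HilbertModule B E]

variable (B E) in
/-- The uniform structure of the strict topology on `L(E)`, defined by the seminorms
`T ↦ ‖T x‖` and `T ↦ ‖T* x‖` for `x : E`. -/
abbrev Adjointable.strictUniformSpace : UniformSpace (Adjointable B E E) :=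
  UniformSpace.comap (fun T : Adjointable B E E => fun x : E => (T x, T.adjoint x)) inferInstance

/-- A completely positive map `φ : A → L(E)` is strict if, for some approximate unit
(of positive contractions) of `A`, the image under `φ` is Cauchy for the strict topology. A net is
represented by its filter of tails. -/
def CompletelyPositiveMap.IsStrict (φ : A →CP Adjointable B E E) : Prop :=
  ∃ l : Filter A, l.IsIncreasingApproximateUnit ∧
    @Cauchy _ (Adjointable.strictUniformSpace B E) (l.map φ)

end Strict

/-- A strict positive C⋆-correspondence from `A` to `B`: a Hilbert `B`-module `E` together with a
strict completely positive map `φ : A → L(E)`. -/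
structure PosCor (A : Type u) [NonUnitalCStarAlgebra A] [PartialOrder A] [StarOrderedRing A]
    (B : Type v) [NonUnitalCStarAlgebra B] [PartialOrder B] [StarOrderedRing B] where
  E : Type w
  [normedAddCommGroup : NormedAddCommGroup E]
  [normedSpace : NormedSpace ℂ E]
  [completeSpace : CompleteSpace E]
  [hilbertModule : HilbertModule B E]
  φ : A →CP Adjointable B E E
  isStrict : φ.IsStrict

namespace PosCor

attribute [instance] normedAddCommGroup normedSpace completeSpace hilbertModule

variable {A : Type u} [NonUnitalCStarAlgebra A] [PartialOrder A] [StarOrderedRing A]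
  {B : Type v} [NonUnitalCStarAlgebra B] [PartialOrder B] [StarOrderedRing B]

/-- A morphism `(E₁, φ₁) → (E₂, φ₂)`: a pair of an adjointable map `η : E₁ → E₂` and a
`*`-automorphism `α` of `A` with `φ₂ (α a) ∘ η = η ∘ φ₁ a` for all `a`. -/
@[ext]
structure Hom (X Y : PosCor.{u, v, w} A B) where
  η : Adjointable B X.E Y.E
  α : A ≃⋆ₐ[ℂ] A
  comp_eq (a : A) : (Y.φ (α a)).comp η = η.comp (X.φ a)

/-- The category of strict positive C⋆-correspondences from `A` to `B`; the composite of `(η, α)`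
followed by `(ξ, β)` is `(ξ ∘ η, β ∘ α)`. -/
instance : Category (PosCor.{u, v, w} A B) where
  Hom := Hom
  id X := ⟨Adjointable.id, StarAlgEquiv.refl ℂ A, fun _ => rfl⟩
  comp {X Y Z} f g := ⟨g.η.comp f.η, f.α.trans g.α, fun a => by
    ext x
    have h1 := congrArg (fun T : Adjointable B X.E Y.E => g.η (T x)) (f.comp_eq a)
    have h2 := congrArg (fun T : Adjointable B Y.E Z.E => T (f.η x)) (g.comp_eq (f.α a))
    exact h2.trans h1⟩

end PosCor

namespace KSGNS

section

variable {A : Type u} [NonUnitalCStarAlgebra A] [PartialOrder A] [StarOrderedRing A]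
  {B : Type v} [NonUnitalCStarAlgebra B] [PartialOrder B] [StarOrderedRing B]
  {E : Type w} [NormedAddCommGroup E] [NormedSpace ℂ E] [CompleteSpace E] [HilbertModule B E]

/-- The algebraic tensor product `A ⊗ E` over `ℂ`, to be equipped with the semi-inner product
`⟨a ⊗ x, b ⊗ y⟩ = ⟨x, φ (a* b) y⟩`. -/
def Pre (_φ : A →CP Adjointable B E E) : Type (max u w) := A ⊗[ℂ] E

namespace Pre

variable (φ : A →CP Adjointable B E E)

instance : AddCommGroup (Pre φ) := inferInstanceAs (AddCommGroup (A ⊗[ℂ] E))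

instance : Module ℂ (Pre φ) := inferInstanceAs (Module ℂ (A ⊗[ℂ] E))

/-- The elementary tensor `a ⊗ x`. -/
def tmul (a : A) (x : E) : Pre φ := a ⊗ₜ[ℂ] x

theorem induction {p : Pre φ → Prop} (htmul : ∀ a x, p (tmul φ a x))
    (hadd : ∀ z w, p z → p w → p (z + w)) (z : Pre φ) : p z := by
  refine TensorProduct.induction_on (R := ℂ) (M := A) (N := E) z ?_ htmul hadd
  have := htmul 0 0
  rwa [tmul, TensorProduct.zero_tmul] at this

/-- The semi-inner product `⟨a ⊗ x, b ⊗ y⟩ = ⟨x, φ (a* b) y⟩` as a sesquilinear map. -/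
def innerₛₗ : Pre φ →ₗ⋆[ℂ] Pre φ →ₗ[ℂ] B :=
  TensorProduct.lift <| LinearMap.mk₂'ₛₗ (starRingEnd ℂ) (starRingEnd ℂ)
    (fun (a : A) (x : E) => (TensorProduct.lift <| LinearMap.mk₂ ℂ
      (fun (b : A) (y : E) => inner B x (φ (star a * b) y))
      (fun b b' y => by
        simp only [mul_add, map_add, Adjointable.add_apply, SemiInnerModule.inner_add_right])
      (fun z b y => by
        simp only [mul_smul_comm, map_smul, Adjointable.smul_apply,
          SemiInnerModule.inner_smul_right])
      (fun b y y' => by simp only [Adjointable.map_add, SemiInnerModule.inner_add_right])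
      (fun z b y => by simp only [Adjointable.map_smul, SemiInnerModule.inner_smul_right]) :
        A ⊗[ℂ] E →ₗ[ℂ] B))
    (fun a a' x => TensorProduct.ext' fun b y => by
      change inner B x (φ (star (a + a') * b) y) =
        inner B x (φ (star a * b) y) + inner B x (φ (star a' * b) y)
      rw [star_add, add_mul, map_add, Adjointable.add_apply, SemiInnerModule.inner_add_right])
    (fun z a x => TensorProduct.ext' fun b y => by
      change inner B x (φ (star (z • a) * b) y) = star z • inner B x (φ (star a * b) y)
      rw [star_smul, smul_mul_assoc, map_smul, Adjointable.smul_apply,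
        SemiInnerModule.inner_smul_right])
    (fun a x x' => TensorProduct.ext' fun b y => SemiInnerModule.inner_add_left _ _ _)
    (fun z a x => TensorProduct.ext' fun b y => SemiInnerModule.inner_smul_left _ _ _)

theorem innerₛₗ_tmul (a b : A) (x y : E) :
    innerₛₗ φ (tmul φ a x) (tmul φ b y) = inner B x (φ (star a * b) y) := rfl

theorem star_innerₛₗ (z w : Pre φ) : star (innerₛₗ φ z w) = innerₛₗ φ w z := by
  induction z using induction with
  | hadd z z' hz hz' => rw [map_add, LinearMap.add_apply, star_add, hz, hz', map_add]
  | htmul a x =>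
    induction w using induction with
    | hadd w w' hw hw' => rw [map_add, star_add, hw, hw', map_add, LinearMap.add_apply]
    | htmul b y =>
      rw [innerₛₗ_tmul, innerₛₗ_tmul, SemiInnerModule.star_inner, Adjointable.inner_left]
      have : φ (star b * a) = star (φ (star a * b)) := by
        rw [← map_star, star_mul, star_star]
      rw [this]
      rfl

theorem exists_eq_star_mul_self {D : Type*} [NonUnitalCStarAlgebra D] [PartialOrder D]
    [StarOrderedRing D] {M : D} (h : 0 ≤ M) : ∃ N : D, M = star N * N :=
  CStarAlgebra.nonneg_iff_eq_star_mul_self.1 h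

theorem exists_entry_eq {C : Type*} [NonUnitalCStarAlgebra C] [PartialOrder C]
    [StarOrderedRing C] {n : ℕ} {M : CStarMatrix (Fin n) (Fin n) C} (h : 0 ≤ M) :
    ∃ N : CStarMatrix (Fin n) (Fin n) C, ∀ i j, M i j = ∑ k, star (N k i) * N k j := by
  obtain ⟨N, hN⟩ := exists_eq_star_mul_self h
  refine ⟨N, fun i j => ?_⟩
  rw [hN, CStarMatrix.mul_apply]
  rfl

theorem sum_inner_nonneg {n : ℕ} (a : Fin n → A) (x : Fin n → E) :
    0 ≤ ∑ j, ∑ i, inner B (x i) (φ (star (a i) * a j) (x j)) := by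
  rcases Nat.eq_zero_or_pos n with rfl | hn
  · simp
  have : NeZero n := ⟨hn.ne'⟩
  let R : CStarMatrix (Fin n) (Fin n) A := CStarMatrix.ofMatrix fun i j => if i = 0 then a j else 0
  have hR (i j : Fin n) : (star R * R) i j = star (a i) * a j := by
    rw [CStarMatrix.mul_apply, Finset.sum_eq_single 0]
    · rfl
    · intro k _ hk
      change star (if k = 0 then a i else 0) * (if k = 0 then a j else 0) = 0
      simp [hk]
    · simp
  obtain ⟨N, hN⟩ := exists_entry_eq
    (φ.map_cstarMatrix_nonneg (star R * R) (star_mul_self_nonneg R))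
  have h2 (i j : Fin n) : φ (star (a i) * a j) = ∑ k, star (N k i) * N k j := by
    rw [← hN, CStarMatrix.map_apply, hR]
  have h4 : ∑ j, ∑ i, ∑ k, inner B (N k i (x i)) (N k j (x j)) =
      ∑ k, inner B (∑ i, N k i (x i)) (∑ j, N k j (x j)) := by
    simp_rw [SemiInnerModule.inner_sum_left, SemiInnerModule.inner_sum_right]
    rw [Finset.sum_comm]
    conv_rhs => rw [Finset.sum_comm]
    refine Finset.sum_congr rfl fun i _ => ?_
    rw [Finset.sum_comm]
  simp_rw [h2, Adjointable.sum_apply, SemiInnerModule.inner_sum_right, Adjointable.inner_star_mul, h4]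
  exact Finset.sum_nonneg fun k _ => SemiInnerModule.inner_self_nonneg _

theorem innerₛₗ_self_nonneg (z : Pre φ) : 0 ≤ innerₛₗ φ z z := by
  obtain ⟨n, a, x, rfl⟩ := TensorProduct.exists_sum_tmul_eq (R := ℂ) (M := A) (N := E) z
  have h := sum_inner_nonneg φ a x
  change 0 ≤ innerₛₗ φ (∑ j, tmul φ (a j) (x j)) (∑ j, tmul φ (a j) (x j))
  simpa only [map_sum, LinearMap.sum_apply, innerₛₗ_tmul] using h

/-- The linear map `x ↦ x b` on `E`. -/
def opSMulₗ (b : B) : E →ₗ[ℂ] E where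
  toFun x := op b • x
  map_add' := SemiInnerModule.op_smul_add b
  map_smul' z x := SemiInnerModule.op_smul_smul z b x

/-- The right action `(a ⊗ x) b = a ⊗ x b`. -/
instance : SMul Bᵐᵒᵖ (Pre φ) :=
  ⟨fun b z => TensorProduct.map (R := ℂ) (M := A) (N := E) LinearMap.id (opSMulₗ b.unop) z⟩

theorem op_smul_tmul (b : B) (a : A) (x : E) : op b • tmul φ a x = tmul φ a (op b • x) := rfl

theorem op_smul_add (b : B) (z w : Pre φ) : op b • (z + w) = op b • z + op b • w :=
  map_add (TensorProduct.map (R := ℂ) (M := A) (N := E) LinearMap.id (opSMulₗ b)) z w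

theorem op_smul_smul (z : ℂ) (b : B) (w : Pre φ) : op b • z • w = z • op b • w :=
  map_smul (TensorProduct.map (R := ℂ) (M := A) (N := E) LinearMap.id (opSMulₗ b)) z w

theorem tmul_add (a : A) (x y : E) : tmul φ a (x + y) = tmul φ a x + tmul φ a y :=
  TensorProduct.tmul_add a x y

theorem smul_tmul (z : ℂ) (a : A) (x : E) : z • tmul φ a x = tmul φ a (z • x) :=
  (TensorProduct.tmul_smul z a x).symm

/-- `A ⊗ E` as a semi-inner product `B`-module. -/
instance : SemiInnerModule B (Pre φ) where
  inner z w := innerₛₗ φ z w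
  op_smul_add := op_smul_add φ
  add_op_smul b c z := by
    induction z using induction with
    | htmul a x => simp only [op_smul_tmul, SemiInnerModule.add_op_smul, tmul_add]
    | hadd z w hz hw => rw [op_smul_add, op_smul_add, op_smul_add, hz, hw]; abel
  mul_op_smul b c z := by
    induction z using induction with
    | htmul a x => simp only [op_smul_tmul, SemiInnerModule.mul_op_smul]
    | hadd z w hz hw => rw [op_smul_add, op_smul_add, op_smul_add, hz, hw]
  smul_op_smul c b z := by
    induction z using induction with
    | htmul a x => simp only [op_smul_tmul, SemiInnerModule.smul_op_smul, smul_tmul]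
    | hadd z w hz hw => rw [op_smul_add, op_smul_add, smul_add, hz, hw]
  op_smul_smul := op_smul_smul φ
  inner_self_nonneg := innerₛₗ_self_nonneg φ
  inner_add_right x y z := map_add _ _ _
  inner_smul_right x y z := map_smul _ _ _
  star_inner := star_innerₛₗ φ
  inner_op_smul_right z w b := by
    induction w using induction with
    | hadd w w' hw hw' => rw [op_smul_add, map_add, map_add, hw, hw', add_mul]
    | htmul c y =>
      induction z using induction with
      | hadd z z' hz hz' =>
        rw [map_add, LinearMap.add_apply, LinearMap.add_apply, hz, hz', add_mul]
      | htmul a x =>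
        rw [op_smul_tmul, innerₛₗ_tmul, innerₛₗ_tmul, Adjointable.map_op_smul,
          SemiInnerModule.inner_op_smul_right]

theorem inner_tmul (a b : A) (x y : E) :
    inner B (tmul φ a x) (tmul φ b y) = inner B x (φ (star a * b) y) := rfl

/-- The seminorm `‖z‖ = ‖⟨z, z⟩‖ ^ (1 / 2)`. -/
instance : Norm (Pre φ) := ⟨fun z => √‖inner B z z‖⟩

theorem norm_def (z : Pre φ) : ‖z‖ = √‖inner B z z‖ := rfl

theorem seminormedSpaceCore : SeminormedSpace.Core ℂ (Pre φ) where
  norm_nonneg _ := Real.sqrt_nonneg _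
  norm_smul z x := SemiInnerModule.sqrt_norm_inner_smul z x
  norm_triangle := SemiInnerModule.sqrt_norm_inner_add_le

instance : SeminormedAddCommGroup (Pre φ) := SeminormedAddCommGroup.ofCore (seminormedSpaceCore φ)

instance : NormedSpace ℂ (Pre φ) where
  norm_smul_le z x := (SemiInnerModule.sqrt_norm_inner_smul z x).le

theorem norm_inner_le (z w : Pre φ) : ‖inner B z w‖ ≤ ‖z‖ * ‖w‖ :=
  SemiInnerModule.norm_inner_le z w

/-- The semi-inner product as a continuous sesquilinear map. -/
def innerSL : Pre φ →L⋆[ℂ] Pre φ →L[ℂ] B :=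
  LinearMap.mkContinuous₂ (innerₛₗ φ) 1 fun x y => by
    rw [one_mul]
    exact norm_inner_le φ x y

theorem continuous_inner : Continuous fun p : Pre φ × Pre φ => inner B p.1 p.2 := by
  change Continuous fun p : Pre φ × Pre φ => innerSL φ p.1 p.2
  fun_prop

instance : UniformContinuousConstSMul Bᵐᵒᵖ (Pre φ) where
  uniformContinuous_const_smul b := by
    refine (LipschitzWith.of_dist_le_mul (K := ‖b.unop‖₊) fun z w => ?_).uniformContinuous
    rw [dist_eq_norm, dist_eq_norm, show b • z - b • w = b • (z - w) from
      (SemiInnerModule.op_smul_sub b.unop z w).symm]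
    exact SemiInnerModule.sqrt_norm_inner_op_smul_le b.unop (z - w)

end Pre

end


section

variable {A : Type u} [NonUnitalCStarAlgebra A] [PartialOrder A] [StarOrderedRing A]
  {B : Type v} [NonUnitalCStarAlgebra B] [PartialOrder B] [StarOrderedRing B]
  {E : Type w} [NormedAddCommGroup E] [NormedSpace ℂ E] [CompleteSpace E] [HilbertModule B E]
  (φ : A →CP Adjointable B E E)

/-- The Hilbert `B`-module `F_φ = A ⊗_φ E`: the completion of the quotient of the algebraic tensor
product `A ⊗ E` by the submodule `N_φ` of all `z` with `⟨z, z⟩ = 0`. (`UniformSpace.Completion` is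
the Hausdorff completion, so it passes to the quotient by the elements of seminorm zero.) -/
def Space : Type (max u w) := UniformSpace.Completion (Pre φ)

namespace Space

open UniformSpace

instance : NormedAddCommGroup (Space φ) :=
  inferInstanceAs (NormedAddCommGroup (Completion (Pre φ)))

instance : NormedSpace ℂ (Space φ) := inferInstanceAs (NormedSpace ℂ (Completion (Pre φ)))

instance : CompleteSpace (Space φ) := inferInstanceAs (CompleteSpace (Completion (Pre φ)))

/-- The canonical map from `A ⊗ E` to its completion, as a linear map. -/
def ofPre : Pre φ →ₗ[ℂ] Space φ where
  toFun z := (z : Completion (Pre φ))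
  map_add' := Completion.coe_add
  map_smul' := Completion.coe_smul

/-- The right action on `F_φ`, extended by continuity from `A ⊗ E`. -/
instance : SMul Bᵐᵒᵖ (Space φ) := inferInstanceAs (SMul Bᵐᵒᵖ (Completion (Pre φ)))

/-- The inner product on `F_φ`, extended by continuity from `A ⊗ E`. -/
instance : Inner B (Space φ) := inferInstanceAs (Inner B (Completion (Pre φ)))

theorem ofPre_op_smul (b : B) (z : Pre φ) : ofPre φ (op b • z) = op b • ofPre φ z :=
  Completion.coe_smul (op b) z

theorem continuous_op_smul (b : B) : Continuous fun x : Space φ => op b • x :=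
  Completion.continuous_map

theorem continuous_ofPre : Continuous (ofPre φ) := Completion.continuous_coe (Pre φ)

theorem norm_ofPre (z : Pre φ) : ‖ofPre φ z‖ = ‖z‖ := Completion.norm_coe z

theorem denseRange_ofPre : DenseRange (ofPre φ) := Completion.denseRange_coe

theorem inner_ofPre (z w : Pre φ) : inner B (ofPre φ z) (ofPre φ w) = inner B z w :=
  (Completion.isDenseInducing_coe.prodMap Completion.isDenseInducing_coe).extend_eq
    (Pre.continuous_inner φ) (z, w)

theorem continuous_inner : Continuous fun p : Space φ × Space φ => inner B p.1 p.2 := by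
  let f : Pre φ →+ Pre φ →+ B :=
    { toFun := fun x => (Pre.innerₛₗ φ x).toAddMonoidHom
      map_zero' := by ext x; simp
      map_add' := fun x y => by ext z; simp }
  have h : Continuous fun p : Pre φ × Pre φ => f p.1 p.2 := Pre.continuous_inner φ
  exact (Completion.isDenseInducing_toCompl (Pre φ)).extend_Z_bilin
    (Completion.isDenseInducing_toCompl (Pre φ)) h

theorem continuous_inner₂ {α : Type*} [TopologicalSpace α] {f g : α → Space φ}
    (hf : Continuous f) (hg : Continuous g) : Continuous fun x => inner B (f x) (g x) :=
  (continuous_inner φ).comp (hf.prodMk hg)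

theorem induction {p : Space φ → Prop} (hp : IsClosed {x | p x}) (h : ∀ z, p (ofPre φ z))
    (x : Space φ) : p x :=
  Completion.induction_on (α := Pre φ) x hp h

instance : SemiInnerModule B (Space φ) where
  op_smul_add b x y := by
    have hc := continuous_op_smul φ b
    induction x using induction with
    | hp => exact isClosed_eq (hc.comp (continuous_add_const y)) (hc.add continuous_const)
    | h z =>
      induction y using induction with
      | hp => exact isClosed_eq (hc.comp (continuous_const_add _)) (continuous_const.add hc)
      | h w =>
        rw [← map_add, ← ofPre_op_smul, SemiInnerModule.op_smul_add, map_add,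
          ofPre_op_smul, ofPre_op_smul]
  add_op_smul b c x := by
    induction x using induction with
    | hp =>
      exact isClosed_eq (continuous_op_smul φ _)
        ((continuous_op_smul φ b).add (continuous_op_smul φ c))
    | h z =>
      rw [← ofPre_op_smul, SemiInnerModule.add_op_smul, map_add, ofPre_op_smul,
        ofPre_op_smul]
  mul_op_smul b c x := by
    induction x using induction with
    | hp =>
      exact isClosed_eq (continuous_op_smul φ _)
        ((continuous_op_smul φ c).comp (continuous_op_smul φ b))
    | h z => rw [← ofPre_op_smul, SemiInnerModule.mul_op_smul, ofPre_op_smul, ofPre_op_smul]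
  smul_op_smul t b x := by
    induction x using induction with
    | hp => exact isClosed_eq (continuous_op_smul φ _) ((continuous_op_smul φ b).const_smul t)
    | h z => rw [← ofPre_op_smul, SemiInnerModule.smul_op_smul, map_smul, ofPre_op_smul]
  op_smul_smul t b x := by
    induction x using induction with
    | hp =>
      exact isClosed_eq ((continuous_op_smul φ _).comp (continuous_const_smul t))
        ((continuous_op_smul φ b).const_smul t)
    | h z =>
      rw [← map_smul, ← ofPre_op_smul, SemiInnerModule.op_smul_smul, map_smul,
        ofPre_op_smul]
  inner_self_nonneg x := by
    induction x using induction with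
    | hp => exact isClosed_le continuous_const (continuous_inner₂ φ continuous_id continuous_id)
    | h z => rw [inner_ofPre]; exact SemiInnerModule.inner_self_nonneg z
  inner_add_right x y y' := by
    have hc (x : Space φ) : Continuous fun y => inner B x y :=
      continuous_inner₂ φ continuous_const continuous_id
    have hd (y : Space φ) : Continuous fun x => inner B x y :=
      continuous_inner₂ φ continuous_id continuous_const
    induction x using induction with
    | hp => exact isClosed_eq (hd _) ((hd _).add (hd _))
    | h z =>
      induction y using induction with
      | hp =>
        exact isClosed_eq ((hc _).comp (continuous_add_const y'))
          ((hc _).add continuous_const)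
      | h w =>
        induction y' using induction with
        | hp =>
          exact isClosed_eq ((hc _).comp (continuous_const_add _))
            (continuous_const.add (hc _))
        | h w' =>
          rw [← map_add, inner_ofPre, inner_ofPre, inner_ofPre,
            SemiInnerModule.inner_add_right]
  inner_smul_right x y t := by
    have hc (x : Space φ) : Continuous fun y => inner B x y :=
      continuous_inner₂ φ continuous_const continuous_id
    have hd (y : Space φ) : Continuous fun x => inner B x y :=
      continuous_inner₂ φ continuous_id continuous_const
    induction x using induction with
    | hp => exact isClosed_eq (hd _) ((hd _).const_smul t)
    | h z =>
      induction y using induction with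
      | hp => exact isClosed_eq ((hc _).comp (continuous_const_smul t)) ((hc _).const_smul t)
      | h w => rw [← map_smul, inner_ofPre, inner_ofPre, SemiInnerModule.inner_smul_right]
  star_inner x y := by
    have hc (x : Space φ) : Continuous fun y => inner B x y :=
      continuous_inner₂ φ continuous_const continuous_id
    have hd (y : Space φ) : Continuous fun x => inner B x y :=
      continuous_inner₂ φ continuous_id continuous_const
    induction x using induction with
    | hp => exact isClosed_eq (hd _).star (hc _)
    | h z =>
      induction y using induction with
      | hp => exact isClosed_eq (hc _).star (hd _)
      | h w => rw [inner_ofPre, inner_ofPre, SemiInnerModule.star_inner]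
  inner_op_smul_right x y b := by
    have hc (x : Space φ) : Continuous fun y => inner B x y :=
      continuous_inner₂ φ continuous_const continuous_id
    have hd (y : Space φ) : Continuous fun x => inner B x y :=
      continuous_inner₂ φ continuous_id continuous_const
    induction x using induction with
    | hp => exact isClosed_eq (hd _) ((hd _).mul_const b)
    | h z =>
      induction y using induction with
      | hp => exact isClosed_eq ((hc _).comp (continuous_op_smul φ b)) ((hc _).mul_const b)
      | h w =>
        rw [← ofPre_op_smul, inner_ofPre, inner_ofPre,
          SemiInnerModule.inner_op_smul_right]

theorem norm_eq_sqrt (x : Space φ) : ‖x‖ = √‖inner B x x‖ := by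
  induction x using induction with
  | hp =>
    exact isClosed_eq continuous_norm
      (continuous_inner₂ φ continuous_id continuous_id).norm.sqrt
  | h z => rw [norm_ofPre, inner_ofPre]; rfl

instance : HilbertModule B (Space φ) where
  inner_self_eq_zero x := by
    rw [← norm_eq_zero (a := x), norm_eq_sqrt, Real.sqrt_eq_zero (norm_nonneg _), norm_eq_zero]
  norm_eq_sqrt := norm_eq_sqrt φ

/-- The class of the elementary tensor `a ⊗ x` in `F_φ`. -/
def tmul (a : A) (x : E) : Space φ := ofPre φ (Pre.tmul φ a x)

end Space

namespace Pre

/-- The action `a ⊗ x ↦ u a ⊗ x` of the unitization of `A` on `A ⊗ E`. -/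
def lmul (c : A⁺¹) : Pre φ →ₗ[ℂ] Pre φ :=
  TensorProduct.map (R := ℂ) (M := A) (N := E)
    (c.fst • LinearMap.id + LinearMap.mulLeft ℂ c.snd) LinearMap.id

theorem lmul_tmul (c : A⁺¹) (a : A) (x : E) :
    lmul φ c (tmul φ a x) = tmul φ (c.fst • a + c.snd * a) x := rfl

theorem lmul_inr_tmul (b : A) (a : A) (x : E) :
    lmul φ (b : A⁺¹) (tmul φ a x) = tmul φ (b * a) x := by
  rw [lmul_tmul, Unitization.fst_inr, Unitization.snd_inr, zero_smul, zero_add]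

theorem coe_lmul {C : Type*} [NonUnitalCStarAlgebra C] (c : C⁺¹) (a : C) :
    ((c.fst • a + c.snd * a : C) : C⁺¹) = c * (a : C⁺¹) := by
  ext <;> simp

theorem add_tmul (a b : A) (x : E) : tmul φ (a + b) x = tmul φ a x + tmul φ b x :=
  TensorProduct.add_tmul a b x

theorem lmul_mul (c d : A⁺¹) (z : Pre φ) : lmul φ (c * d) z = lmul φ c (lmul φ d z) := by
  induction z using induction with
  | hadd z w hz hw => simp only [map_add, hz, hw]
  | htmul a x =>
    simp only [lmul_tmul]
    congr 1
    apply Unitization.inr_injective (R := ℂ)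
    rw [coe_lmul, coe_lmul, coe_lmul, mul_assoc]

theorem lmul_add (c d : A⁺¹) (z : Pre φ) : lmul φ (c + d) z = lmul φ c z + lmul φ d z := by
  induction z using induction with
  | hadd z w hz hw => simp only [map_add, hz, hw]; abel
  | htmul a x =>
    rw [lmul_tmul, lmul_tmul, lmul_tmul, ← add_tmul, Unitization.fst_add, Unitization.snd_add,
      add_smul, add_mul]
    congr 1
    abel

theorem lmul_smul (t : ℂ) (c : A⁺¹) (z : Pre φ) : lmul φ (t • c) z = t • lmul φ c z := by
  induction z using induction with
  | hadd z w hz hw => simp only [map_add, hz, hw, smul_add]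
  | htmul a x =>
    rw [lmul_tmul, lmul_tmul, Unitization.fst_smul, Unitization.snd_smul, smul_mul_assoc,
      smul_assoc, ← smul_add]
    rfl

theorem lmul_one (z : Pre φ) : lmul φ 1 z = z := by
  induction z using induction with
  | hadd z w hz hw => simp only [map_add, hz, hw]
  | htmul a x =>
    rw [lmul_tmul, Unitization.fst_one, Unitization.snd_one, one_smul, zero_mul, add_zero]

theorem inner_lmul_left (c : A⁺¹) (z w : Pre φ) :
    inner B (lmul φ c z) w = inner B z (lmul φ (star c) w) := by
  induction z using induction with
  | hadd z z' hz hz' =>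
    rw [map_add, SemiInnerModule.inner_add_left, SemiInnerModule.inner_add_left, hz, hz']
  | htmul a x =>
    induction w using induction with
    | hadd w w' hw hw' =>
      rw [map_add, SemiInnerModule.inner_add_right, SemiInnerModule.inner_add_right, hw, hw']
    | htmul b y =>
      rw [lmul_tmul, lmul_tmul, inner_tmul, inner_tmul]
      congr 3
      apply Unitization.inr_injective (R := ℂ)
      rw [Unitization.inr_mul, Unitization.inr_mul, coe_lmul, Unitization.inr_star, coe_lmul,
        star_mul, mul_assoc, Unitization.inr_star]

theorem norm_lmul_le (c : A⁺¹) (z : Pre φ) : ‖lmul φ c z‖ ≤ ‖c‖ * ‖z‖ := by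
  obtain ⟨d, hd⟩ : ∃ d : A⁺¹, ((‖c‖ ^ 2 : ℝ) : ℂ) • (1 : A⁺¹) = star c * c + star d * d := by
    have h : star c * c ≤ algebraMap ℝ A⁺¹ (‖c‖ ^ 2) := by
      have := IsSelfAdjoint.le_algebraMap_norm_self (IsSelfAdjoint.star_mul_self c)
      rwa [CStarRing.norm_star_mul_self, ← sq] at this
    obtain ⟨d, hd⟩ := exists_eq_star_mul_self (sub_nonneg.2 h)
    refine ⟨d, ?_⟩
    rw [← hd, add_sub_cancel, Complex.coe_smul, Algebra.algebraMap_eq_smul_one]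
  have h1 : ((‖c‖ ^ 2 : ℝ) : ℂ) • inner B z z =
      inner B (lmul φ c z) (lmul φ c z) + inner B (lmul φ d z) (lmul φ d z) := by
    rw [inner_lmul_left, inner_lmul_left, ← SemiInnerModule.inner_add_right, ← lmul_mul,
      ← lmul_mul, ← lmul_add, ← hd, lmul_smul, lmul_one, SemiInnerModule.inner_smul_right]
  have h2 : inner B (lmul φ c z) (lmul φ c z) ≤ ((‖c‖ ^ 2 : ℝ) : ℂ) • inner B z z := by
    rw [h1]
    exact le_add_of_nonneg_right (SemiInnerModule.inner_self_nonneg _)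
  rw [norm_def, norm_def]
  refine Real.sqrt_le_left (by positivity) |>.2 ?_
  rw [mul_pow, Real.sq_sqrt (norm_nonneg _)]
  refine (CStarAlgebra.norm_le_norm_of_nonneg_of_le
    (SemiInnerModule.inner_self_nonneg _) h2).trans_eq ?_
  rw [norm_smul, Complex.norm_real, Real.norm_of_nonneg (by positivity)]

theorem uniformContinuous_lmul (c : A⁺¹) : UniformContinuous (lmul φ c) :=
  ((lmul φ c).mkContinuous ‖c‖ (norm_lmul_le φ c)).uniformContinuous

end Pre

end

end KSGNS

namespace KSGNS

section

variable {A : Type u} [NonUnitalCStarAlgebra A] [PartialOrder A] [StarOrderedRing A]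
  {B : Type v} [NonUnitalCStarAlgebra B] [PartialOrder B] [StarOrderedRing B]
  {E : Type w} [NormedAddCommGroup E] [NormedSpace ℂ E] [CompleteSpace E] [HilbertModule B E]
  (φ : A →CP Adjointable B E E)

namespace Space

open UniformSpace

/-- Left multiplication by `a` on `F_φ`, extended by continuity from `A ⊗ E`. -/
def lmul (a : A) (x : Space φ) : Space φ := Completion.map (Pre.lmul φ (a : A⁺¹)) x

theorem continuous_lmul (a : A) : Continuous (lmul φ a) := Completion.continuous_map

theorem lmul_ofPre (a : A) (z : Pre φ) : lmul φ a (ofPre φ z) = ofPre φ (Pre.lmul φ (a : A⁺¹) z) :=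
  Completion.map_coe (Pre.uniformContinuous_lmul φ a) z

theorem lmul_tmul (a b : A) (x : E) : lmul φ a (tmul φ b x) = tmul φ (a * b) x := by
  rw [tmul, lmul_ofPre, Pre.lmul_inr_tmul, tmul]

theorem norm_lmul_le (a : A) (x : Space φ) : ‖lmul φ a x‖ ≤ ‖a‖ * ‖x‖ := by
  induction x using induction with
  | hp => exact isClosed_le (continuous_lmul φ a).norm (continuous_norm.const_mul _)
  | h z =>
    rw [lmul_ofPre, norm_ofPre, norm_ofPre, ← Unitization.norm_inr (𝕜 := ℂ)]
    exact Pre.norm_lmul_le φ a z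

theorem inner_lmul_left (a : A) (x y : Space φ) :
    inner B (lmul φ a x) y = inner B x (lmul φ (star a) y) := by
  induction x using induction with
  | hp =>
    exact isClosed_eq (continuous_inner₂ φ (continuous_lmul φ a) continuous_const)
      (continuous_inner₂ φ continuous_id continuous_const)
  | h z =>
    induction y using induction with
    | hp =>
      exact isClosed_eq (continuous_inner₂ φ continuous_const continuous_id)
        (continuous_inner₂ φ continuous_const (continuous_lmul φ (star a)))
    | h w =>
      rw [lmul_ofPre, lmul_ofPre, inner_ofPre, inner_ofPre, Pre.inner_lmul_left,
        Unitization.inr_star]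

/-- Left multiplication by `a` as an adjointable map. -/
def lmulAdj (a : A) : Adjointable B (Space φ) (Space φ) where
  toFun := lmul φ a
  adjFun := lmul φ (star a)
  inner_toFun_left := inner_lmul_left φ a

theorem lmulAdj_apply (a : A) (x : Space φ) : lmulAdj φ a x = lmul φ a x := rfl

/-- Left multiplication as a `*`-homomorphism `A → L(F_φ)`. -/
def lmulHom : A →⋆ₙₐ[ℂ] Adjointable B (Space φ) (Space φ) where
  toFun := lmulAdj φ
  map_smul' t a := by
    ext x
    change lmul φ (t • a) x = t • lmul φ a x
    induction x using induction with
    | hp => exact isClosed_eq (continuous_lmul φ _) ((continuous_lmul φ a).const_smul t)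
    | h z => rw [lmul_ofPre, lmul_ofPre, Unitization.inr_smul, Pre.lmul_smul, map_smul]
  map_add' a b := by
    ext x
    change lmul φ (a + b) x = lmul φ a x + lmul φ b x
    induction x using induction with
    | hp => exact isClosed_eq (continuous_lmul φ _) ((continuous_lmul φ a).add (continuous_lmul φ b))
    | h z => rw [lmul_ofPre, lmul_ofPre, lmul_ofPre, Unitization.inr_add, Pre.lmul_add, map_add]
  map_mul' a b := by
    ext x
    change lmul φ (a * b) x = lmul φ a (lmul φ b x)
    induction x using induction with
    | hp => exact isClosed_eq (continuous_lmul φ _) ((continuous_lmul φ a).comp (continuous_lmul φ b))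
    | h z => rw [lmul_ofPre, lmul_ofPre, lmul_ofPre, Unitization.inr_mul, Pre.lmul_mul]
  map_zero' := by
    ext x
    change lmul φ 0 x = 0
    induction x using induction with
    | hp => exact isClosed_eq (continuous_lmul φ _) continuous_const
    | h z =>
      rw [lmul_ofPre, ← zero_smul ℂ (0 : A), Unitization.inr_smul, Pre.lmul_smul, zero_smul,
        map_zero]
  map_star' a := by
    ext x
    rfl

theorem norm_tmul_sq (a : A) (x : E) : ‖tmul φ a x‖ ^ 2 = ‖inner B x (φ (star a * a) x)‖ := by
  rw [HilbertModule.norm_sq_eq (B := B), tmul, inner_ofPre, Pre.inner_tmul]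

theorem tmul_sub (a b : A) (x : E) : tmul φ (a - b) x = tmul φ a x - tmul φ b x := by
  rw [tmul, tmul, tmul, ← map_sub]
  exact congrArg (ofPre φ) (TensorProduct.sub_tmul a b x)

theorem tendsto_lmul_tmul {l : Filter A} (hl : l.IsIncreasingApproximateUnit) (a : A) (x : E) :
    Tendsto (fun e => lmul φ e (tmul φ a x)) l (𝓝 (tmul φ a x)) := by
  have hφ : Continuous fun b : A => φ b := map_continuous φ
  have h1 : Continuous fun b : A => √(‖φ (star b * b)‖ * ‖x‖ ^ 2) := by fun_prop
  have h2 : Tendsto (fun e => e * a - a) l (𝓝 0) := by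
    rw [← sub_self a]
    exact (hl.tendsto_mul_right a).sub_const a
  have h3 := (h1.tendsto 0).comp h2
  rw [mul_zero, map_zero, norm_zero, zero_mul, Real.sqrt_zero] at h3
  rw [tendsto_iff_norm_sub_tendsto_zero]
  refine squeeze_zero (fun _ => norm_nonneg _) (fun e => ?_) h3
  rw [lmul_tmul, ← tmul_sub]
  refine Real.le_sqrt_of_sq_le ?_
  rw [norm_tmul_sq]
  refine (HilbertModule.norm_inner_le_norm _ _).trans ?_
  have := (φ (star (e * a - a) * (e * a - a))).norm_apply_le x
  calc _ ≤ ‖x‖ * (‖φ (star (e * a - a) * (e * a - a))‖ * ‖x‖) := by gcongr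
    _ = _ := by ring

theorem tendsto_lmul {l : Filter A} (hl : l.IsIncreasingApproximateUnit) (x : Space φ) :
    Tendsto (fun e => lmul φ e x) l (𝓝 x) := by
  have h0 (z : Pre φ) : Tendsto (fun e => lmul φ e (ofPre φ z)) l (𝓝 (ofPre φ z)) := by
    induction z using Pre.induction with
    | hadd z w hz hw =>
      rw [map_add]
      refine (hz.add hw).congr fun e => ?_
      rw [← map_add, lmul_ofPre, lmul_ofPre, lmul_ofPre, map_add, map_add]
    | htmul a x => exact tendsto_lmul_tmul φ hl a x
  refine Metric.tendsto_nhds.2 fun ε hε => ?_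
  obtain ⟨z, hz⟩ := Metric.denseRange_iff.1 (denseRange_ofPre φ) x (ε / 3) (by positivity)
  filter_upwards [Metric.tendsto_nhds.1 (h0 z) (ε / 3) (by positivity), hl.eventually_norm]
    with e he he1
  have h1 : dist (lmul φ e x) (lmul φ e (ofPre φ z)) ≤ dist x (ofPre φ z) := by
    rw [dist_eq_norm, dist_eq_norm, ← lmulAdj_apply, ← lmulAdj_apply,
      show lmulAdj φ e x - lmulAdj φ e (ofPre φ z) = lmulAdj φ e (x - ofPre φ z) from
        ((lmulAdj φ e).toLinearMap.map_sub _ _).symm]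
    exact (norm_lmul_le φ e _).trans (mul_le_of_le_one_left (norm_nonneg _) he1)
  have h2 := dist_triangle4 (lmul φ e x) (lmul φ e (ofPre φ z)) (ofPre φ z) x
  rw [dist_comm (ofPre φ z) x] at h2
  linarith

end Space

/-- The completely positive map `π_φ : A → L(F_φ)` with `π_φ(a) (b ⊗ x) = a b ⊗ x`. -/
def π : A →CP Adjointable B (Space φ) (Space φ) :=
  CompletelyPositiveMapClass.toCompletelyPositiveLinearMap (Space.lmulHom φ)

theorem π_apply (a : A) (x : Space φ) : π φ a x = Space.lmul φ a x := rfl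

theorem π_tmul (a b : A) (x : E) : π φ a (Space.tmul φ b x) = Space.tmul φ (a * b) x :=
  Space.lmul_tmul φ a b x

theorem π_isStrict : (π φ).IsStrict := by
  have hl := CStarAlgebra.increasingApproximateUnit A
  have := hl.neBot
  refine ⟨_, hl, ?_⟩
  let f : Adjointable B (Space φ) (Space φ) → Space φ → Space φ × Space φ :=
    fun T x => (T x, T.adjoint x)
  let _ := Adjointable.strictUniformSpace B (Space φ)
  have hf : IsUniformInducing f := ⟨rfl⟩
  rw [← hf.cauchy_map_iff, Filter.map_map]
  have h : Tendsto (f ∘ π φ) (CStarAlgebra.approximateUnit A) (𝓝 fun x => (x, x)) := by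
    refine tendsto_pi_nhds.2 fun x => Tendsto.prodMk_nhds (Space.tendsto_lmul φ hl x) ?_
    refine (Space.tendsto_lmul φ hl x).congr' ?_
    filter_upwards [hl.eventually_star_eq] with e he
    change Space.lmul φ e x = Space.lmul φ (star e) x
    rw [he]
  exact h.cauchy_map

end

/-- The object part `(E, φ) ↦ (F_φ, π_φ)` of the KSGNS construction. -/
def obj {A : Type u} [NonUnitalCStarAlgebra A] [PartialOrder A] [StarOrderedRing A]
    {B : Type v} [NonUnitalCStarAlgebra B] [PartialOrder B] [StarOrderedRing B]
    (X : PosCor.{u, v, max u w} A B) : PosCor.{u, v, max u w} A B where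
  E := Space X.φ
  φ := π X.φ
  isStrict := π_isStrict X.φ

end KSGNS

end

/-!
The algebraic tensor map `α ⊗ η : A ⊗ E → A ⊗ F` of a morphism `(η, α)` has a formal adjoint for the
semi-inner products, namely `α⁻¹ ⊗ η*`: taking adjoints in `ψ (α a) η = η φ a` shows that `(η*, α⁻¹)`
is an intertwiner in the other direction (`KSGNS.adjoint_intertwines`, `KSGNS.Pre.inner_map_left`).

The point is that `α ⊗ η` is bounded, so that it passes to the completions. One has
`⟨(α ⊗ η) z, (α ⊗ η) z⟩ = ⟨z, (1 ⊗ η* η) z⟩`, where `η* η` commutes with every `φ a`. The positive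
element `‖η* η‖ - η* η` of the C⋆-algebra `L(E)` has a square root `k`, which commutes with every
`φ a` as well, and so
`‖η* η‖ ⟨z, z⟩ - ⟨(α ⊗ η) z, (α ⊗ η) z⟩ = ⟨(1 ⊗ k) z, (1 ⊗ k) z⟩ ≥ 0` (`KSGNS.Pre.norm_map_le`).

Everything else follows from density: an adjointable map out of `F_φ` is determined by its values on
elementary tensors (`KSGNS.Space.adjointable_ext`). This gives the intertwining relation for the
extended map, the functor laws, and uniqueness.
-/

noncomputable section

namespace KSGNS

variable {A : Type u} [NonUnitalCStarAlgebra A] [PartialOrder A] [StarOrderedRing A]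
  {B : Type v} [NonUnitalCStarAlgebra B] [PartialOrder B] [StarOrderedRing B]
  {E : Type w₁} [NormedAddCommGroup E] [NormedSpace ℂ E] [CompleteSpace E] [HilbertModule B E]
  {F : Type w₂} [NormedAddCommGroup F] [NormedSpace ℂ F] [CompleteSpace F] [HilbertModule B F]
  {G : Type w₃} [NormedAddCommGroup G] [NormedSpace ℂ G] [CompleteSpace G] [HilbertModule B G]
  {φ : A →CP Adjointable B E E} {ψ : A →CP Adjointable B F F}
  {η : Adjointable B E F} {α : A ≃⋆ₐ[ℂ] A}

/-! ### Intertwiners -/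

theorem intertwines_apply (h : ∀ a, (ψ (α a)).comp η = η.comp (φ a)) (a : A) (x : E) :
    ψ (α a) (η x) = η (φ a x) :=
  congrArg (fun T : Adjointable B E F => T x) (h a)

/-- The relation `ψ (α a) η = η φ a`, applied to `(α⁻¹ a)*`, has `φ (α⁻¹ a) η* = η* ψ a` as its
adjoint. -/
theorem adjoint_intertwines (h : ∀ a, (ψ (α a)).comp η = η.comp (φ a)) (a : A) :
    (φ (α.symm a)).comp η.adjoint = η.adjoint.comp (ψ a) := by
  have h1 := congrArg Adjointable.adjoint (h (star (α.symm a)))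
  have h2 : (φ (star (α.symm a))).adjoint = φ (α.symm a) := by
    change star (φ (star (α.symm a))) = _
    rw [← map_star, star_star]
  have h3 : (ψ (α (star (α.symm a)))).adjoint = ψ a := by
    change star (ψ (α (star (α.symm a)))) = _
    rw [← map_star, map_star α, star_star, StarAlgEquiv.apply_symm_apply]
  change η.adjoint.comp (ψ (α (star (α.symm a)))).adjoint =
    (φ (star (α.symm a))).adjoint.comp η.adjoint at h1
  rw [h2, h3] at h1
  exact h1.symm

/-! ### The algebraic tensor map and its boundedness -/

namespace Pre

variable (φ ψ η α) in
/-- The map `α ⊗ η : a ⊗ x ↦ α a ⊗ η x` between the algebraic tensor products. -/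
def map : Pre φ →ₗ[ℂ] Pre ψ :=
  TensorProduct.map (R := ℂ) (M := A) (N := E)
    { toFun := α, map_add' := map_add α, map_smul' := map_smul α } η.toLinearMap

theorem map_tmul (a : A) (x : E) : map φ ψ η α (tmul φ a x) = tmul ψ (α a) (η x) := rfl

theorem inner_map_left (h : ∀ a, (ψ (α a)).comp η = η.comp (φ a)) (z : Pre φ) (w : Pre ψ) :
    inner B (map φ ψ η α z) w = inner B z (map ψ φ η.adjoint α.symm w) := by
  induction z using induction with
  | hadd z z' hz hz' =>
    rw [_root_.map_add, SemiInnerModule.inner_add_left, SemiInnerModule.inner_add_left, hz, hz']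
  | htmul a x =>
    induction w using induction with
    | hadd w w' hw hw' =>
      rw [_root_.map_add, SemiInnerModule.inner_add_right, SemiInnerModule.inner_add_right, hw, hw']
    | htmul b y =>
      rw [map_tmul, map_tmul, inner_tmul, inner_tmul, Adjointable.inner_left,
        ← intertwines_apply (adjoint_intertwines h), map_mul, map_star,
        StarAlgEquiv.symm_apply_apply]

/-- The square root `k` of `‖η* η‖ - η* η` commutes with every `φ a`, so that `1 ⊗ k` has a formal
adjoint; this turns `‖η* η‖ ⟨z, z⟩ - ⟨(α ⊗ η) z, (α ⊗ η) z⟩` into the square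
`⟨(1 ⊗ k) z, (1 ⊗ k) z⟩`. -/
theorem norm_map_le (h : ∀ a, (ψ (α a)).comp η = η.comp (φ a)) (z : Pre φ) :
    ‖map φ ψ η α z‖ ≤ √‖(η.adjoint.comp η : Adjointable B E E)‖ * ‖z‖ := by
  set c : Adjointable B E E := η.adjoint.comp η with hc
  have hcs : IsSelfAdjoint c := rfl
  have hcomm (a : A) : Commute c (φ a) := by
    ext x
    have h1 := intertwines_apply (adjoint_intertwines h) (α a) (η x)
    rw [StarAlgEquiv.symm_apply_apply, intertwines_apply h] at h1
    exact h1.symm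
  set d : Adjointable B E E := algebraMap ℝ _ ‖c‖ - c with hd
  have hd0 : 0 ≤ d := sub_nonneg.2 hcs.le_algebraMap_norm_self
  set k : Adjointable B E E := CFC.sqrt d with hk
  have hks : star k = k := (CFC.sqrt_nonneg d).isSelfAdjoint
  have hkk : k * k = d := CFC.sqrt_mul_sqrt_self d
  have hkcomm (a : A) : Commute k (φ a) := by
    have h1 : Commute d (φ a) := Commute.sub_left (Algebra.commutes _ _) (hcomm a)
    rw [hk, CFC.sqrt_eq_real_sqrt d]
    exact (IsSelfAdjoint.of_nonneg hd0).commute_cfcₙ h1 _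
  have hki (a : A) : (φ ((StarAlgEquiv.refl ℂ A) a)).comp k = k.comp (φ a) := (hkcomm a).eq.symm
  have key : (‖c‖ : ℂ) • inner B z z = inner B (map φ ψ η α z) (map φ ψ η α z) +
      inner B (map φ φ k (.refl ℂ A) z) (map φ φ k (.refl ℂ A) z) := by
    rw [inner_map_left h, inner_map_left hki, ← SemiInnerModule.inner_add_right,
      ← SemiInnerModule.inner_smul_right]
    congr 1
    induction z using induction with
    | hadd z w hz hw =>
      simp only [_root_.map_add, smul_add, hz, hw]
      abel
    | htmul a x =>
      have hx : (‖c‖ : ℂ) • x = η.adjoint (η x) + k.adjoint (k x) := by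
        change _ = c x + (star k * k) x
        rw [hks, hkk, ← Adjointable.add_apply, hd, add_sub_cancel,
          Algebra.algebraMap_eq_smul_one, ← Complex.coe_smul]
        rfl
      rw [map_tmul, map_tmul, map_tmul, map_tmul, StarAlgEquiv.symm_apply_apply,
        StarAlgEquiv.symm_apply_apply, ← tmul_add, smul_tmul, hx]
  have hle : inner B (map φ ψ η α z) (map φ ψ η α z) ≤ (‖c‖ : ℂ) • inner B z z := by
    rw [key]
    exact le_add_of_nonneg_right (SemiInnerModule.inner_self_nonneg _)
  rw [norm_def, norm_def, ← Real.sqrt_mul (norm_nonneg _)]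
  refine Real.sqrt_le_sqrt ((CStarAlgebra.norm_le_norm_of_nonneg_of_le
    (SemiInnerModule.inner_self_nonneg _) hle).trans_eq ?_)
  rw [norm_smul, Complex.norm_real, norm_norm]

theorem uniformContinuous_map (h : ∀ a, (ψ (α a)).comp η = η.comp (φ a)) :
    UniformContinuous (map φ ψ η α) :=
  ((map φ ψ η α).mkContinuous _ (norm_map_le h)).uniformContinuous

end Pre

/-! ### Extension to the completions -/

namespace Space

open UniformSpace

variable (φ ψ η α) in
/-- The extension by continuity of `α ⊗ η` to `F_φ → F_ψ`; meaningful when `(η, α)` is an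
intertwiner, so that `α ⊗ η` is uniformly continuous. -/
def map (x : Space φ) : Space ψ := Completion.map (Pre.map φ ψ η α) x

theorem continuous_map : Continuous (map φ ψ η α) := Completion.continuous_map

theorem map_ofPre (h : ∀ a, (ψ (α a)).comp η = η.comp (φ a)) (z : Pre φ) :
    map φ ψ η α (ofPre φ z) = ofPre ψ (Pre.map φ ψ η α z) :=
  Completion.map_coe (Pre.uniformContinuous_map h) z

theorem inner_map_left (h : ∀ a, (ψ (α a)).comp η = η.comp (φ a)) (x : Space φ) (y : Space ψ) :
    inner B (map φ ψ η α x) y = inner B x (map ψ φ η.adjoint α.symm y) := by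
  induction x using induction with
  | hp =>
    exact isClosed_eq (continuous_inner₂ ψ continuous_map continuous_const)
      (continuous_inner₂ φ continuous_id continuous_const)
  | h z =>
    induction y using induction with
    | hp =>
      exact isClosed_eq (continuous_inner₂ ψ continuous_const continuous_id)
        (continuous_inner₂ φ continuous_const continuous_map)
    | h w =>
      rw [map_ofPre h, map_ofPre (adjoint_intertwines h), inner_ofPre, inner_ofPre,
        Pre.inner_map_left h]

/-- The extension of `α ⊗ η` as an adjointable map `F_φ → F_ψ`, with adjoint the extension of
`α⁻¹ ⊗ η*`. -/
def mapAdj (h : ∀ a, (ψ (α a)).comp η = η.comp (φ a)) : Adjointable B (Space φ) (Space ψ) where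
  toFun := map φ ψ η α
  adjFun := map ψ φ η.adjoint α.symm
  inner_toFun_left := inner_map_left h

theorem mapAdj_tmul (h : ∀ a, (ψ (α a)).comp η = η.comp (φ a)) (a : A) (x : E) :
    mapAdj h (tmul φ a x) = tmul ψ (α a) (η x) :=
  map_ofPre h (Pre.tmul φ a x)

theorem adjointable_ext {S T : Adjointable B (Space φ) G}
    (h : ∀ a x, S (tmul φ a x) = T (tmul φ a x)) : S = T := by
  ext x
  induction x using induction with
  | hp => exact isClosed_eq S.continuous T.continuous
  | h z =>
    induction z using Pre.induction with
    | hadd z w hz hw => rw [map_add, S.map_add, T.map_add, hz, hw]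
    | htmul a x => exact h a x

end Space

end KSGNS

/-! ### The functor -/

namespace KSGNS

variable {A : Type u} [NonUnitalCStarAlgebra A] [PartialOrder A] [StarOrderedRing A]
  {B : Type v} [NonUnitalCStarAlgebra B] [PartialOrder B] [StarOrderedRing B]

theorem hom_ext {X : PosCor.{u, v, max u w} A B} {Z : PosCor.{u, v, max u w} A B}
    {f g : PosCor.Hom (obj.{u, v, w} X) Z} (hα : f.α = g.α)
    (hη : ∀ a x, f.η (Space.tmul X.φ a x) = g.η (Space.tmul X.φ a x)) : f = g :=
  PosCor.Hom.ext (Space.adjointable_ext hη) hα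

/-- The morphism `(η̃, α)` with `η̃ (a ⊗ x) = α a ⊗ η x` induced by a morphism `(η, α)`. -/
def homMap {X Y : PosCor.{u, v, max u w} A B} (f : PosCor.Hom X Y) :
    PosCor.Hom (obj.{u, v, w} X) (obj.{u, v, w} Y) where
  η := Space.mapAdj f.comp_eq
  α := f.α
  comp_eq a := Space.adjointable_ext fun b x => by
    change π Y.φ (f.α a) (Space.mapAdj f.comp_eq (Space.tmul X.φ b x)) =
      Space.mapAdj f.comp_eq (π X.φ a (Space.tmul X.φ b x))
    rw [π_tmul, Space.mapAdj_tmul, Space.mapAdj_tmul, π_tmul, map_mul]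

theorem homMap_η_tmul {X Y : PosCor.{u, v, max u w} A B} (f : PosCor.Hom X Y) (a : A) (x : X.E) :
    (homMap.{u, v, w} f).η (Space.tmul X.φ a x) = Space.tmul Y.φ (f.α a) (f.η x) :=
  Space.mapAdj_tmul f.comp_eq a x

variable (A B) in
/-- The KSGNS construction as an endofunctor of `PosCor A B`. -/
def functor : PosCor.{u, v, max u w} A B ⥤ PosCor.{u, v, max u w} A B where
  obj := obj.{u, v, w}
  map f := homMap.{u, v, w} f
  map_id X := hom_ext rfl fun a x => homMap_η_tmul (𝟙 X) a x
  map_comp {X Y Z} f g := hom_ext rfl fun a x => by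
    change (homMap.{u, v, w} (f ≫ g)).η (Space.tmul X.φ a x) =
      (homMap.{u, v, w} g).η ((homMap.{u, v, w} f).η (Space.tmul X.φ a x))
    rw [homMap_η_tmul, homMap_η_tmul, homMap_η_tmul]
    rfl

end KSGNS

end

theorem mainTheorem1 (A : Type u) [NonUnitalCStarAlgebra A] [PartialOrder A] [StarOrderedRing A]
    (B : Type v) [NonUnitalCStarAlgebra B] [PartialOrder B] [StarOrderedRing B] :
    ∃! F : PosCor.{u, v, max u w} A B ⥤ PosCor.{u, v, max u w} A B,
      ∃ map : ∀ {X Y : PosCor.{u, v, max u w} A B},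
          PosCor.Hom X Y → PosCor.Hom (KSGNS.obj.{u, v, w} X) (KSGNS.obj.{u, v, w} Y),
        F.toPrefunctor = { obj := KSGNS.obj.{u, v, w}, map := map } ∧
        ∀ (X Y : PosCor.{u, v, max u w} A B) (f : PosCor.Hom X Y),
          (map f).α = f.α ∧
          ∀ (a : A) (x : X.E),
            (map f).η (KSGNS.Space.tmul X.φ a x) = KSGNS.Space.tmul Y.φ (f.α a) (f.η x) := by
  refine ⟨KSGNS.functor.{u, v, w} A B, ⟨KSGNS.homMap.{u, v, w}, rfl, fun X Y f =>
    ⟨rfl, KSGNS.homMap_η_tmul.{u, v, w} f⟩⟩, ?_⟩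
  rintro G ⟨map, hG, hmap⟩
  have h : @map = @KSGNS.homMap.{u, v, w} A _ _ _ B _ _ _ := by
    funext X Y f
    exact KSGNS.hom_ext (hmap X Y f).1 fun a x =>
      ((hmap X Y f).2 a x).trans (KSGNS.homMap_η_tmul f a x).symm
  subst h
  -- Once `map` is known, `hG` fixes all the data of `G`; the functor laws are propositions.
  cases G
  cases hG
  rfl
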